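/- Let $d\ge 0$ and let $\rho_0,\rho_1$ be Lebesgue-absolutely continuous probability measures on $\mathbb{R}^d$. (Absolutely continuous measures are identified with their densities.) Let $$F(\rho)=\kappa_0\int V\rho\,dx+\kappa_1\int U(\rho(x))\,dx+\kappa_2\iint W(x-y)\rho(x)\rho(y)\,dx\,dy+G(\rho),$$ where $\kappa_0,\kappa_1,\kappa_2\ge 0$, $V,W:\mathbb{R}^d\to\mathbb{R}$ and $U:\mathbb{R}\to\mathbb{R}$ are functions, and $G$ is an arbitrary $[-\infty,+\infty]$-valued functional (for instance $G=0$ or the Fisher information). Integrals take values in $[-\infty,+\infty]$; undefined ones, and $\infty-\infty$, count as $+\infty$, and a path of infinite total kinetic energy has action $+\infty$. Dynamic problem: minimize $$\mathcal{D}(\rho,v)=\int_0^1\Big(\int_{\mathbb{R}^d}\tfrac12\|v(t,x)\|^2\rho(t,x)\,dx+F(\rho(t))\Big)dt$$ over pairs $(\rho,v)$ such that $t\mapsto\rho(t,\cdot)$, $t\in[0,1]$, is a weakly continuous path of probability densities with $\rho(0,\cdot)=\rho_0$ and $\rho(1,\cdot)=\rho_1$; $v:[0,1]\times\mathbb{R}^d\to\mathbb{R}^d$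 is a continuous velocity field whose differential equation $y'=v(t,y)$ is classically well posed, that is, for every $(s,x)\in[0,1]\times\mathbb{R}^d$ there is exactly one solution on all of $[0,1]$ with $y(s)=x$, and for each fixed $s$ it is a $C^1$ function of $(t,x)\in[0,1]\times\mathbb{R}^d$; and $\partial_t\rho+\nabla\cdot(\rho v)=0$ holds weakly on $(0,1)\times\mathbb{R}^d$. Static problem: let $\mathcal{T}_{\rho_0,\rho_1}$ be the set of $C^1$-diffeomorphisms $T$ of $\mathbb{R}^d$ onto itself with $T_\#\rho_0=\rho_1$ and $\det DT>0$ everywhere, and let $\tilde\Pi$ be the set of couplings of $\rho_0$ and $\rho_1$ of the form $(\mathrm{id},T)_\#\rho_0$ with $T\in\mathcal{T}_{\rho_0,\rho_1}$. For $\pi\in\tilde\Pi$ let $\Gamma(\pi)$ be the set of $\gamma\in C^1([0,1]\times\mathbb{R}^d,\mathbb{R}^d)$ such that $\gamma_0=\mathrm{id}$, each $\gamma_t$ is a $C^1$-diffeomorphism of $\mathbb{R}^d$ onto itself, and $(\gamma_0,\gamma_1)_\#\rho_0=\pi$. Put $$\mathcal{A}(\gamma)=\mathbb{E}_{x\sim\rho_0}\Big[\int_0^1\tfrac12\Big\|\frac{d}{dt}\gamma_t(x)\Big\|^2dt\Big]+\int_0^1F\big((\gamma_t)_\#\rho_0\big)\,dt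 .$$ Then the two problems are equivalent: they have the same value in $[-\infty,+\infty]$, $$\inf_{(\rho,v)}\mathcal{D}(\rho,v)=\inf_{\pi\in\tilde\Pi}\ \inf_{\gamma\in\Gamma(\pi)}\mathcal{A}(\gamma)$$ (an infimum over the empty set being $+\infty$). Moreover, for every admissible $(\rho,v)$ there are $\pi\in\tilde\Pi$ and $\gamma\in\Gamma(\pi)$, and conversely for every $\pi\in\tilde\Pi$ and $\gamma\in\Gamma(\pi)$ there is an admissible $(\rho,v)$, such that $\gamma$ is the flow of $v$ (that is, $\gamma_0=\mathrm{id}$ and $\frac{d}{dt}\gamma_t(x)=v(t,\gamma_t(x))$), $\rho(t,\cdot)=(\gamma_t)_\#\rho_0$ for all $t\in[0,1]$, and $\mathcal{D}(\rho,v)=\mathcal{A}(\gamma)$. -/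

import Mathlib

open Set Filter Topology MeasureTheory
open scoped NNReal ENNReal Manifold

noncomputable section

namespace DensityPath

/-- The state space `ℝᵈ` with its Euclidean norm. -/
abbrev Space (d : ℕ) : Type := EuclideanSpace ℝ (Fin d)

/-! ### Extended-real integrals

In a minimization problem the undefined expression `∞ - ∞` is given the value `+∞`. -/

/-- Addition of extended reals, with the convention `∞ - ∞ = +∞`. -/
def addTop (a b : EReal) : EReal := -(-a + -b)

/-- The integral `∫ f⁺ - ∫ f⁻` of an extended-real function, with the convention that it is `+∞`
when `∫ f⁺ = ∞` (in particular for `∞ - ∞`) and when `f` is not measurable. -/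
def extIntegral {α : Type*} [MeasurableSpace α] (μ : Measure α) (f : α → EReal) : EReal :=
  open Classical in
  if AEMeasurable f μ ∧ ∫⁻ a, (f a).toENNReal ∂μ ≠ ⊤ then
    ((∫⁻ a, (f a).toENNReal ∂μ : ℝ≥0∞) : EReal) - ((∫⁻ a, (-f a).toENNReal ∂μ : ℝ≥0∞) : EReal)
  else ⊤

/-- Lebesgue measure on the time interval `[0, 1]`. -/
abbrev timeMeasure : Measure ℝ := (volume : Measure ℝ).restrict (Icc 0 1)

variable {d : ℕ}

/-- `κ₀ ∫ V(x) ρ(x) dx + κ₁ ∫ U(ρ(x)) dx + κ₂ ∫∫ W(x - y) ρ(x) ρ(y) dx dy`, where `ρ` is the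
Lebesgue density of `μ`. -/
def potentialEnergy (κ₀ κ₁ κ₂ : ℝ≥0) (V : Space d → ℝ) (U : ℝ → ℝ) (W : Space d → ℝ)
    (μ : Measure (Space d)) : EReal :=
  addTop
    (addTop
      (((κ₀ : ℝ) : EReal) * extIntegral μ (fun x => (V x : EReal)))
      (((κ₁ : ℝ) : EReal) *
        extIntegral volume (fun x => (U (μ.rnDeriv volume x).toReal : EReal))))
    (((κ₂ : ℝ) : EReal) *
      extIntegral (μ.prod μ) (fun p : Space d × Space d => (W (p.1 - p.2) : EReal)))

/-! ### The dynamic problem -/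

/-- `y` solves `y'(t) = v(t, y(t))` on `[0, 1]` (with one-sided derivatives at the endpoints). -/
def IsTrajectory (v : ℝ → Space d → Space d) (y : ℝ → Space d) : Prop :=
  ∀ t ∈ Icc (0 : ℝ) 1, HasDerivWithinAt y (v t (y t)) (Icc 0 1) t

/-- The continuous velocity fields on `[0, 1] × ℝᵈ` whose ordinary differential equation is
classically well posed: from every initial time and position there is a trajectory on the whole
interval `[0, 1]`, it is unique, and it depends in a `C¹` way on time and initial position. -/
structure IsFlowField (v : ℝ → Space d → Space d) : Prop where
  continuousOn : ContinuousOn (fun p : ℝ × Space d => v p.1 p.2) (Icc 0 1 ×ˢ univ)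
  unique : ∀ y z : ℝ → Space d, IsTrajectory v y → IsTrajectory v z →
    ∀ s ∈ Icc (0 : ℝ) 1, y s = z s → EqOn y z (Icc 0 1)
  exists_smooth : ∀ s ∈ Icc (0 : ℝ) 1, ∃ Y : ℝ → Space d → Space d,
    ContDiffOn ℝ 1 (fun p : ℝ × Space d => Y p.1 p.2) (Icc 0 1 ×ˢ univ) ∧
      ∀ x, Y s x = x ∧ IsTrajectory v (fun t => Y t x)

/-- The continuity equation `∂ₜρ + ∇ · (ρ v) = 0` on `(0, 1) × ℝᵈ`, in the weak sense. Here
`fderiv ℝ φ (t, x) (1, v t x)` is `∂ₜφ(t, x) + ⟨∇φ(t, x), v(t, x)⟩`. For a continuous `v`,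
testing with `C¹` or with smooth compactly supported functions makes no difference. -/
def ContinuityEquation (ρ : ℝ → ProbabilityMeasure (Space d)) (v : ℝ → Space d → Space d) : Prop :=
  ∀ φ : ℝ × Space d → ℝ, ContDiff ℝ 1 φ → HasCompactSupport φ →
    tsupport φ ⊆ Ioo (0 : ℝ) 1 ×ˢ univ →
    ∫ t in (0 : ℝ)..1, ∫ x, fderiv ℝ φ (t, x) (1, v t x) ∂(ρ t : Measure (Space d)) = 0

/-- The admissible pairs of the dynamic problem: a weakly continuous path of probability densities
and a velocity field, satisfying the continuity equation and the endpoint conditions. -/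
structure IsAdmissible (ρ₀ ρ₁ : ProbabilityMeasure (Space d))
    (ρ : ℝ → ProbabilityMeasure (Space d)) (v : ℝ → Space d → Space d) : Prop where
  flowField : IsFlowField v
  continuousOn : ContinuousOn ρ (Icc 0 1)
  absolutelyContinuous : ∀ t ∈ Icc (0 : ℝ) 1, (ρ t : Measure (Space d)) ≪ volume
  continuityEquation : ContinuityEquation ρ v
  initial : ρ 0 = ρ₀
  final : ρ 1 = ρ₁

/-- The kinetic energy `∫ ½ ‖v(t, x)‖² ρ(t, x) dx` at time `t`. -/
def kineticEnergy (ρ : ℝ → ProbabilityMeasure (Space d)) (v : ℝ → Space d → Space d) (t : ℝ) :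
    ℝ≥0∞ :=
  ∫⁻ x, ‖v t x‖ₑ ^ 2 / 2 ∂(ρ t : Measure (Space d))

/-- The dynamic action `∫₀¹ (∫ ½ ‖v(t, x)‖² ρ(t, x) dx + F(ρ(t))) dt`; it is `+∞` when the total
kinetic energy is infinite. -/
def dynamicAction (F : Measure (Space d) → EReal) (ρ : ℝ → ProbabilityMeasure (Space d))
    (v : ℝ → Space d → Space d) : EReal :=
  open Classical in
  if ∫⁻ t, kineticEnergy ρ v t ∂timeMeasure = ⊤ then ⊤
  else extIntegral timeMeasure
    (fun t => addTop (kineticEnergy ρ v t : EReal) (F (ρ t : Measure (Space d))))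

/-- The value of the dynamic problem. -/
def dynamicValue (F : Measure (Space d) → EReal) (ρ₀ ρ₁ : ProbabilityMeasure (Space d)) : EReal :=
  ⨅ (ρ : ℝ → ProbabilityMeasure (Space d)) (v : ℝ → Space d → Space d)
    (_ : IsAdmissible ρ₀ ρ₁ ρ v), dynamicAction F ρ v

/-! ### The static problem -/

/-- `T` is a `C¹`-diffeomorphism of `ℝᵈ` onto itself. -/
def IsDiffeo (T : Space d → Space d) : Prop :=
  ∃ e : Diffeomorph 𝓘(ℝ, Space d) 𝓘(ℝ, Space d) (Space d) (Space d) 1, ⇑e = T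

/-- The orientation-preserving diffeomorphisms pushing `ρ₀` forward to `ρ₁`. -/
def transportMaps (ρ₀ ρ₁ : ProbabilityMeasure (Space d)) : Set (Space d → Space d) :=
  {T | IsDiffeo T ∧ (ρ₀ : Measure (Space d)).map T = (ρ₁ : Measure (Space d)) ∧
    ∀ x, 0 < (fderiv ℝ T x).det}

/-- The couplings of `ρ₀` and `ρ₁`. -/
def couplings (ρ₀ ρ₁ : ProbabilityMeasure (Space d)) : Set (Measure (Space d × Space d)) :=
  {π | π.map Prod.fst = (ρ₀ : Measure (Space d)) ∧ π.map Prod.snd = (ρ₁ : Measure (Space d))}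

/-- The couplings `(id, T)_# ρ₀` induced by an orientation-preserving diffeomorphism `T`. -/
def diffeoCouplings (ρ₀ ρ₁ : ProbabilityMeasure (Space d)) : Set (Measure (Space d × Space d)) :=
  {π ∈ couplings ρ₀ ρ₁ | ∃ T ∈ transportMaps ρ₀ ρ₁,
    π = (ρ₀ : Measure (Space d)).map (fun x => (x, T x))}

/-- The flow maps `γ ∈ C¹([0, 1] × ℝᵈ, ℝᵈ)` starting at the identity, diffeomorphic at every time,
with `(γ₀, γ₁)_# ρ₀ = π`. -/
structure IsFlowPath (ρ₀ : ProbabilityMeasure (Space d)) (π : Measure (Space d × Space d))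
    (γ : ℝ → Space d → Space d) : Prop where
  contDiffOn : ContDiffOn ℝ 1 (fun p : ℝ × Space d => γ p.1 p.2) (Icc 0 1 ×ˢ univ)
  initial : ∀ x, γ 0 x = x
  diffeo : ∀ t ∈ Icc (0 : ℝ) 1, IsDiffeo (γ t)
  coupling : (ρ₀ : Measure (Space d)).map (fun x => (γ 0 x, γ 1 x)) = π

/-- The action `𝔼_{x ∼ ρ₀} [∫₀¹ ½ ‖d/dt γₜ(x)‖² dt] + ∫₀¹ F((γₜ)_# ρ₀) dt` of a flow path. -/
def pathAction (F : Measure (Space d) → EReal) (ρ₀ : ProbabilityMeasure (Space d))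
    (γ : ℝ → Space d → Space d) : EReal :=
  addTop
    ((∫⁻ x, ∫⁻ t, ‖derivWithin (fun s => γ s x) (Icc 0 1) t‖ₑ ^ 2 / 2 ∂timeMeasure
      ∂(ρ₀ : Measure (Space d)) : ℝ≥0∞) : EReal)
    (extIntegral timeMeasure (fun t => F ((ρ₀ : Measure (Space d)).map (γ t))))

/-- The cost of a coupling. -/
def couplingCost (F : Measure (Space d) → EReal) (ρ₀ : ProbabilityMeasure (Space d))
    (π : Measure (Space d × Space d)) : EReal :=
  ⨅ (γ : ℝ → Space d → Space d) (_ : IsFlowPath ρ₀ π γ), pathAction F ρ₀ γ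

/-- The value of the static problem. -/
def staticValue (F : Measure (Space d) → EReal) (ρ₀ ρ₁ : ProbabilityMeasure (Space d)) : EReal :=
  ⨅ π ∈ diffeoCouplings ρ₀ ρ₁, couplingCost F ρ₀ π

/-- `γ` is the flow of `v`, and `ρ` is the path of densities transported by it. -/
def Corresponds (ρ₀ : ProbabilityMeasure (Space d)) (ρ : ℝ → ProbabilityMeasure (Space d))
    (v γ : ℝ → Space d → Space d) : Prop :=
  (∀ x, γ 0 x = x ∧ IsTrajectory v (fun t => γ t x)) ∧
    ∀ t ∈ Icc (0 : ℝ) 1, (ρ t : Measure (Space d)) = (ρ₀ : Measure (Space d)).map (γ t)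

end DensityPath

end

/-!
Both problems describe the same motion of mass, once in Eulerian coordinates (a velocity field `v`
and the densities `ρ` it transports) and once in Lagrangian coordinates (the flow `γ` of `v`). The
equivalence is a correspondence between the competitors that preserves the action; the two values
then agree because both infima run over the same set of action values.

From Lagrange to Euler, the velocity field is `v(t, y) = ∂ₜγ(t, γₜ⁻¹(y))`. Its continuity requires
that `(t, y) ↦ γₜ⁻¹(y)` is continuous up to the endpoints of the time interval
(`IsDiffeoPath.continuousOn_pathInv`), and uniqueness of its trajectories holds although `v` need
not be Lipschitz: on `(0, 1)` the inverse is jointly `C¹` (`IsDiffeoPath.contDiffAt_pathInv`), and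
the label `γₜ⁻¹(y(t))` of a trajectory `y` has derivative zero
(`IsDiffeoPath.exists_eq_apply_of_isTrajectory`). The push-forwards `(γₜ)_# ρ₀` solve the
continuity equation by the chain rule along trajectories and Fubini's theorem.

From Euler to Lagrange, `γ` is the flow of `v` started at time `0`. It is a path of diffeomorphisms
of positive determinant, because its inverse at time `t` is again given by a flow of `v`, and the
determinant is continuous in time, never zero, and `1` at the start. The remaining point is that
`ρ(t) = (γₜ)_# ρ₀` (`IsDiffeoPath.eq_map_of_continuityEquation`). Testing the continuity equation
with `χ(t) ψ(γₜ⁻¹(x))`, which is constant along trajectories up to the factor `χ`, shows that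
`∫ ψ(γₜ⁻¹(x)) dρ(t)` has weak derivative zero in time. As it is continuous, it is constant, so
`(γₜ⁻¹)_# ρ(t) = ρ₀`.

Finally the actions agree by change of variables and Tonelli's theorem. A finite kinetic energy can
be split off from the extended integral of `F` without any assumption on `F`
(`extIntegral_addTop`), and an infinite one makes both actions `+∞`
(`Corresponds.dynamicAction_eq`).
-/

noncomputable section

namespace DensityPath

variable {d : ℕ}

/-! ### Diffeomorphisms and paths of diffeomorphisms -/

theorem IsDiffeo.exists_inverse {T : Space d → Space d} (hT : IsDiffeo T) :
    ∃ S : Space d → Space d, ContDiff ℝ 1 T ∧ ContDiff ℝ 1 S ∧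
      Function.LeftInverse S T ∧ Function.RightInverse S T := by
  obtain ⟨e, rfl⟩ := hT
  exact ⟨e.symm, contMDiff_iff_contDiff.1 e.contMDiff, contMDiff_iff_contDiff.1 e.symm.contMDiff,
    e.left_inv, e.right_inv⟩

theorem isDiffeo_of_inverse {T S : Space d → Space d} (hT : ContDiff ℝ 1 T) (hS : ContDiff ℝ 1 S)
    (hl : Function.LeftInverse S T) (hr : Function.RightInverse S T) : IsDiffeo T :=
  ⟨{ toFun := T, invFun := S, left_inv := hl, right_inv := hr,
     contMDiff_toFun := contMDiff_iff_contDiff.2 hT,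
     contMDiff_invFun := contMDiff_iff_contDiff.2 hS }, rfl⟩

theorem IsDiffeo.contDiff {T : Space d → Space d} (hT : IsDiffeo T) : ContDiff ℝ 1 T :=
  hT.exists_inverse.choose_spec.1

theorem IsDiffeo.bijective {T : Space d → Space d} (hT : IsDiffeo T) : Function.Bijective T := by
  obtain ⟨S, -, -, hl, hr⟩ := hT.exists_inverse
  exact ⟨hl.injective, hr.surjective⟩

theorem IsDiffeo.contDiff_invFun {T : Space d → Space d} (hT : IsDiffeo T) :
    ContDiff ℝ 1 (Function.invFun T) := by
  obtain ⟨S, -, hS, hl, hr⟩ := hT.exists_inverse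
  have : Function.invFun T = S := by
    funext y
    apply hl.injective
    rw [Function.invFun_eq ⟨S y, hr y⟩, hr y]
  rwa [this]

theorem IsDiffeo.hasFDerivAt_equiv {T : Space d → Space d} (hT : IsDiffeo T) (x : Space d) :
    ∃ e : Space d ≃L[ℝ] Space d, (e : Space d →L[ℝ] Space d) = fderiv ℝ T x := by
  obtain ⟨S, hT, hS, hl, hr⟩ := hT.exists_inverse
  have hTd : ∀ x, HasFDerivAt T (fderiv ℝ T x) x := fun x =>
    (hT.differentiable one_ne_zero x).hasFDerivAt
  have hSd : ∀ x, HasFDerivAt S (fderiv ℝ S x) x := fun x =>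
    (hS.differentiable one_ne_zero x).hasFDerivAt
  have h1 : (fderiv ℝ S (T x)).comp (fderiv ℝ T x) = ContinuousLinearMap.id ℝ _ := by
    have := (hSd (T x)).comp x (hTd x)
    rw [hl.id] at this
    exact this.unique (hasFDerivAt_id x)
  have h2 : (fderiv ℝ T x).comp (fderiv ℝ S (T x)) = ContinuousLinearMap.id ℝ _ := by
    have := (hTd (S (T x))).comp (T x) (hSd (T x))
    rw [hr.id, hl x] at this
    exact this.unique (hasFDerivAt_id _)
  exact ⟨ContinuousLinearEquiv.equivOfInverse (fderiv ℝ T x) (fderiv ℝ S (T x))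
    (fun z => by simpa using congrArg (fun L => L z) h1)
    (fun z => by simpa using congrArg (fun L => L z) h2), by ext; rfl⟩

/-- A `C¹` path of `C¹`-diffeomorphisms of `ℝᵈ`, parametrized by `[0, 1]`. -/
structure IsDiffeoPath (γ : ℝ → Space d → Space d) : Prop where
  contDiffOn : ContDiffOn ℝ 1 (fun p : ℝ × Space d => γ p.1 p.2) (Icc 0 1 ×ˢ univ)
  diffeo : ∀ t ∈ Icc (0 : ℝ) 1, IsDiffeo (γ t)

/-- The time derivative of a path of maps, one-sided at the endpoints of `[0, 1]`. -/
def timeDeriv (γ : ℝ → Space d → Space d) (t : ℝ) (x : Space d) : Space d :=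
  derivWithin (fun s => γ s x) (Icc 0 1) t

/-- The inverse maps `γₜ⁻¹`. -/
def pathInv (γ : ℝ → Space d → Space d) (t : ℝ) : Space d → Space d :=
  Function.invFun (γ t)

/-- The Eulerian velocity field `v(t, y) = ∂ₜγ(t, γₜ⁻¹(y))` of a path of maps. -/
def velocity (γ : ℝ → Space d → Space d) (t : ℝ) (y : Space d) : Space d :=
  timeDeriv γ t (pathInv γ t y)

theorem uniqueDiffOn_Icc_prod_univ :
    UniqueDiffOn ℝ (Icc (0 : ℝ) 1 ×ˢ (univ : Set (Space d))) :=
  (uniqueDiffOn_Icc zero_lt_one).prod uniqueDiffOn_univ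

theorem Icc_prod_univ_mem_nhds {t : ℝ} (ht : t ∈ Ioo (0 : ℝ) 1) (x : Space d) :
    Icc (0 : ℝ) 1 ×ˢ (univ : Set (Space d)) ∈ 𝓝 (t, x) :=
  prod_mem_nhds (Icc_mem_nhds ht.1 ht.2) univ_mem

namespace IsDiffeoPath

variable {γ : ℝ → Space d → Space d} (h : IsDiffeoPath γ)
include h

theorem pathInv_apply {t : ℝ} (ht : t ∈ Icc (0 : ℝ) 1) (x : Space d) :
    pathInv γ t (γ t x) = x :=
  Function.leftInverse_invFun (h.diffeo t ht).bijective.1 x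

theorem apply_pathInv {t : ℝ} (ht : t ∈ Icc (0 : ℝ) 1) (y : Space d) :
    γ t (pathInv γ t y) = y :=
  Function.rightInverse_invFun (h.diffeo t ht).bijective.2 y

theorem hasFDerivWithinAt {t : ℝ} (ht : t ∈ Icc (0 : ℝ) 1) (x : Space d) :
    HasFDerivWithinAt (fun p : ℝ × Space d => γ p.1 p.2)
      (fderivWithin ℝ (fun p : ℝ × Space d => γ p.1 p.2) (Icc 0 1 ×ˢ univ) (t, x))
      (Icc 0 1 ×ˢ univ) (t, x) :=
  ((h.contDiffOn.differentiableOn one_ne_zero) (t, x) ⟨ht, mem_univ x⟩).hasFDerivWithinAt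

theorem continuousOn_fderivWithin : ContinuousOn
    (fderivWithin ℝ (fun p : ℝ × Space d => γ p.1 p.2) (Icc 0 1 ×ˢ univ))
      (Icc 0 1 ×ˢ univ) :=
  h.contDiffOn.continuousOn_fderivWithin uniqueDiffOn_Icc_prod_univ le_rfl

theorem hasDerivWithinAt_fderivWithin {t : ℝ} (ht : t ∈ Icc (0 : ℝ) 1) (x : Space d) :
    HasDerivWithinAt (fun s => γ s x)
      (fderivWithin ℝ (fun p : ℝ × Space d => γ p.1 p.2) (Icc 0 1 ×ˢ univ) (t, x) (1, 0))
      (Icc 0 1) t := by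
  have h1 : HasDerivWithinAt (fun s : ℝ => (s, x)) ((1 : ℝ), (0 : Space d)) (Icc 0 1) t :=
    (hasDerivWithinAt_id t _).prodMk (hasDerivWithinAt_const t _ x)
  exact (h.hasFDerivWithinAt ht x).comp_hasDerivWithinAt (f := fun s : ℝ => (s, x)) t h1
    (fun s hs => ⟨hs, mem_univ x⟩)

theorem timeDeriv_eq {t : ℝ} (ht : t ∈ Icc (0 : ℝ) 1) (x : Space d) :
    timeDeriv γ t x =
      fderivWithin ℝ (fun p : ℝ × Space d => γ p.1 p.2) (Icc 0 1 ×ˢ univ) (t, x) (1, 0) :=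
  (h.hasDerivWithinAt_fderivWithin ht x).derivWithin (uniqueDiffOn_Icc zero_lt_one t ht)

theorem hasDerivWithinAt_timeDeriv {t : ℝ} (ht : t ∈ Icc (0 : ℝ) 1) (x : Space d) :
    HasDerivWithinAt (fun s => γ s x) (timeDeriv γ t x) (Icc 0 1) t := by
  rw [h.timeDeriv_eq ht]
  exact h.hasDerivWithinAt_fderivWithin ht x

theorem continuousOn_timeDeriv :
    ContinuousOn (fun p : ℝ × Space d => timeDeriv γ p.1 p.2) (Icc 0 1 ×ˢ univ) :=
  (h.continuousOn_fderivWithin.clm_apply continuousOn_const).congr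
    fun p hp => h.timeDeriv_eq hp.1 p.2

theorem hasFDerivAt_space {t : ℝ} (ht : t ∈ Icc (0 : ℝ) 1) (x : Space d) :
    HasFDerivAt (γ t) ((fderivWithin ℝ (fun p : ℝ × Space d => γ p.1 p.2) (Icc 0 1 ×ˢ univ)
      (t, x)).comp (ContinuousLinearMap.inr ℝ ℝ (Space d))) x := by
  have h1 : HasFDerivAt (fun x : Space d => (t, x)) (ContinuousLinearMap.inr ℝ ℝ (Space d)) x :=
    hasFDerivAt_prodMk_right t x
  have := (h.hasFDerivWithinAt ht x).comp (f := fun x : Space d => (t, x))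
    (t := Icc (0 : ℝ) 1 ×ˢ univ) (s := univ) x h1.hasFDerivWithinAt (fun y _ => ⟨ht, mem_univ y⟩)
  exact hasFDerivWithinAt_univ.1 this

theorem continuousOn_fderiv_space :
    ContinuousOn (fun p : ℝ × Space d => fderiv ℝ (γ p.1) p.2) (Icc 0 1 ×ˢ univ) :=
  (h.continuousOn_fderivWithin.clm_comp continuousOn_const).congr
    fun p hp => (h.hasFDerivAt_space hp.1 p.2).fderiv

/-- For `t` near `t₀` the map `γₜ` is, on a small ball around `x₀`, a small Lipschitz perturbation
of the invertible linear map `Dγ_{t₀}(x₀)`. Hence its image contains a ball around `γₜ(x₀)` of a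
radius that does not depend on `t`. -/
theorem exists_surjOn_closedBall {t₀ : ℝ} (ht₀ : t₀ ∈ Icc (0 : ℝ) 1) (x₀ : Space d) {ε : ℝ}
    (hε : 0 < ε) : ∃ δ > 0, ∃ η > 0, ∀ t ∈ Icc (0 : ℝ) 1, dist t t₀ < δ →
      SurjOn (γ t) (Metric.closedBall x₀ ε) (Metric.closedBall (γ t x₀) η) := by
  obtain ⟨e, he⟩ := (h.diffeo t₀ ht₀).hasFDerivAt_equiv x₀
  -- a right inverse with positive norm bound, also when the space is a point
  obtain ⟨R, hRpos⟩ : ∃ R : (e : Space d →L[ℝ] Space d).NonlinearRightInverse,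
      (0 : ℝ) < R.nnnorm := by
    refine ⟨⟨e.symm, e.toNonlinearRightInverse.nnnorm + 1, fun y => ?_, e.apply_symm_apply⟩, ?_⟩
    · refine (e.toNonlinearRightInverse.bound y).trans ?_
      gcongr
      linarith
    · positivity
  set c : ℝ≥0 := (R.nnnorm * 2)⁻¹ with hc
  have hc0 : (0 : ℝ) < c := by rw [hc]; push_cast; positivity
  obtain ⟨δ, hδ, hδ'⟩ := Metric.continuousWithinAt_iff.1
    (h.continuousOn_fderiv_space (t₀, x₀) ⟨ht₀, mem_univ _⟩) c hc0
  have hr0 : 0 < min ε (δ / 2) := by positivity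
  have hη : (0 : ℝ) < (R.nnnorm : ℝ)⁻¹ - c := by
    rw [hc]
    push_cast
    rw [mul_inv]
    have : (0 : ℝ) < (R.nnnorm : ℝ)⁻¹ := by positivity
    linarith
  refine ⟨δ, hδ, ((R.nnnorm : ℝ)⁻¹ - c) * min ε (δ / 2), mul_pos hη hr0, fun t ht htδ => ?_⟩
  have happrox : ApproximatesLinearOn (γ t) (e : Space d →L[ℝ] Space d)
      (Metric.closedBall x₀ (min ε (δ / 2))) c := by
    intro x hx y hy
    refine (convex_closedBall x₀ _).norm_image_sub_le_of_norm_hasFDerivWithin_le' (𝕜 := ℝ)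
      (f' := fun x => fderiv ℝ (γ t) x) ?_ ?_ hy hx
    · intro z _
      exact (((h.diffeo t ht).contDiff.differentiable one_ne_zero) z).hasFDerivAt.hasFDerivWithinAt
    · intro z hz
      have hzd : dist ((t, z) : ℝ × Space d) (t₀, x₀) < δ := by
        rw [Prod.dist_eq]
        refine max_lt htδ (lt_of_le_of_lt (Metric.mem_closedBall.1 hz) ?_)
        exact (min_le_right _ _).trans_lt (by linarith)
      have := hδ' (show (t, z) ∈ Icc (0 : ℝ) 1 ×ˢ univ from ⟨ht, mem_univ z⟩) hzd
      rw [dist_eq_norm] at this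
      rw [he]
      exact this.le
  exact (happrox.surjOn_closedBall_of_nonlinearRightInverse R hr0.le Subset.rfl).mono
    (Metric.closedBall_subset_closedBall (min_le_left _ _)) Subset.rfl

/-- The inverse of a path of diffeomorphisms is jointly continuous, up to the endpoints of the time
interval. -/
theorem continuousOn_pathInv :
    ContinuousOn (fun p : ℝ × Space d => pathInv γ p.1 p.2) (Icc 0 1 ×ˢ univ) := by
  rintro ⟨t₀, y₀⟩ ⟨ht₀, -⟩
  obtain ⟨x₀, rfl⟩ := (h.diffeo t₀ ht₀).bijective.2 y₀
  rw [Metric.continuousWithinAt_iff]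
  intro ε hε
  obtain ⟨δ, hδ, η, hη, hsurj⟩ := h.exists_surjOn_closedBall ht₀ x₀ (half_pos hε)
  obtain ⟨δ₁, hδ₁, hδ₁'⟩ := Metric.continuousWithinAt_iff.1
    (h.contDiffOn.continuousOn (t₀, x₀) ⟨ht₀, mem_univ _⟩) (η / 2) (half_pos hη)
  refine ⟨min δ (min δ₁ (η / 2)), lt_min hδ (lt_min hδ₁ (half_pos hη)), ?_⟩
  rintro ⟨t, y⟩ ⟨ht, -⟩ hty
  rw [Prod.dist_eq, max_lt_iff] at hty
  obtain ⟨h1, h2⟩ := hty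
  have h3 : dist (γ t x₀) (γ t₀ x₀) < η / 2 := by
    have h5 : dist ((t, x₀) : ℝ × Space d) (t₀, x₀) < δ₁ := by
      rw [Prod.dist_eq, dist_self]
      exact max_lt (h1.trans_le ((min_le_right _ _).trans (min_le_left _ _))) hδ₁
    have h6 : (t, x₀) ∈ Icc (0 : ℝ) 1 ×ˢ (univ : Set (Space d)) := ⟨ht, mem_univ _⟩
    have := hδ₁' h6 h5
    exact this
  have h4 : dist y (γ t₀ x₀) < η / 2 := h2.trans_le ((min_le_right _ _).trans (min_le_right _ _))
  have hyball : y ∈ Metric.closedBall (γ t x₀) η := by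
    rw [Metric.mem_closedBall]
    have := dist_triangle_right y (γ t x₀) (γ t₀ x₀)
    linarith
  obtain ⟨x, hx, rfl⟩ := hsurj t ht (h1.trans_le (min_le_left _ _)) hyball
  change dist (pathInv γ t (γ t x)) (pathInv γ t₀ (γ t₀ x₀)) < ε
  rw [h.pathInv_apply ht, h.pathInv_apply ht₀]
  exact (Metric.mem_closedBall.1 hx).trans_lt (half_lt_self hε)

theorem contDiffAt_pathInv {t : ℝ} (ht : t ∈ Ioo (0 : ℝ) 1) (y : Space d) :
    ContDiffAt ℝ 1 (fun p : ℝ × Space d => pathInv γ p.1 p.2) (t, y) := by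
  have hsub : Ioo (0 : ℝ) 1 ×ˢ (univ : Set (Space d)) ⊆ Icc (0 : ℝ) 1 ×ˢ univ :=
    prod_mono Ioo_subset_Icc_self Subset.rfl
  let Φ : OpenPartialHomeomorph (ℝ × Space d) (ℝ × Space d) :=
    { toFun := fun p => (p.1, γ p.1 p.2)
      invFun := fun p => (p.1, pathInv γ p.1 p.2)
      source := Ioo (0 : ℝ) 1 ×ˢ univ
      target := Ioo (0 : ℝ) 1 ×ˢ univ
      map_source' := fun p hp => ⟨hp.1, mem_univ _⟩
      map_target' := fun p hp => ⟨hp.1, mem_univ _⟩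
      left_inv' := fun p hp => by simp [h.pathInv_apply (Ioo_subset_Icc_self hp.1)]
      right_inv' := fun p hp => by simp [h.apply_pathInv (Ioo_subset_Icc_self hp.1)]
      open_source := isOpen_Ioo.prod isOpen_univ
      open_target := isOpen_Ioo.prod isOpen_univ
      continuousOn_toFun := continuousOn_fst.prodMk (h.contDiffOn.continuousOn.mono hsub)
      continuousOn_invFun := continuousOn_fst.prodMk (h.continuousOn_pathInv.mono hsub) }
  have ht' := Ioo_subset_Icc_self ht
  set x := pathInv γ t y with hx
  have hγ : ContDiffAt ℝ 1 (fun p : ℝ × Space d => γ p.1 p.2) (t, x) :=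
    (h.contDiffOn (t, x) ⟨ht', mem_univ _⟩).contDiffAt (Icc_prod_univ_mem_nhds ht x)
  have hΦ : ContDiffAt ℝ 1 Φ (t, x) := contDiffAt_fst.prodMk hγ
  obtain ⟨e, he⟩ := (h.diffeo t ht').hasFDerivAt_equiv x
  have hfd := (hγ.differentiableAt one_ne_zero).hasFDerivAt
  set L := fderiv ℝ (fun p : ℝ × Space d => γ p.1 p.2) (t, x) with hL
  have hLe : ∀ z, L (0, z) = e z := by
    intro z
    have h1 := hfd.comp (f := fun x : Space d => (t, x)) x (hasFDerivAt_prodMk_right t x)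
    have h2 : HasFDerivAt (γ t) (e : Space d →L[ℝ] Space d) x := by
      rw [he]
      exact (((h.diffeo t ht').contDiff.differentiable one_ne_zero) x).hasFDerivAt
    have := congrArg (fun A : Space d →L[ℝ] Space d => A z) (h1.unique h2)
    simpa using this
  -- the block triangular derivative of `(t, x) ↦ (t, γₜ(x))`
  let Q : (ℝ × Space d) ≃L[ℝ] (ℝ × Space d) :=
    (ContinuousLinearEquiv.refl ℝ ℝ).skewProd e (L.comp (ContinuousLinearMap.inl ℝ ℝ (Space d)))
  have hQ : HasFDerivAt Φ (Q : (ℝ × Space d) →L[ℝ] (ℝ × Space d)) (t, x) := by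
    have h1 : HasFDerivAt Φ ((ContinuousLinearMap.fst ℝ ℝ (Space d)).prod L) (t, x) :=
      hasFDerivAt_fst.prodMk hfd
    convert h1 using 1
    refine ContinuousLinearMap.ext fun p => ?_
    have : L p = L (p.1, 0) + L (0, p.2) := by rw [← map_add]; simp
    refine Prod.ext rfl ?_
    change e p.2 + L (p.1, 0) = L p
    rw [this, hLe, add_comm]
  have := Φ.contDiffAt_symm (n := 1) (a := (t, y)) ⟨ht, mem_univ _⟩ hQ hΦ
  exact contDiffAt_snd.comp (t, y) this

theorem continuousOn_velocity :
    ContinuousOn (fun p : ℝ × Space d => velocity γ p.1 p.2) (Icc 0 1 ×ˢ univ) :=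
  h.continuousOn_timeDeriv.comp (continuousOn_fst.prodMk h.continuousOn_pathInv)
    fun _ hp => ⟨hp.1, mem_univ _⟩

theorem isTrajectory_velocity (x : Space d) : IsTrajectory (velocity γ) (fun t => γ t x) := by
  intro t ht
  have := h.hasDerivWithinAt_timeDeriv ht x
  rwa [velocity, h.pathInv_apply ht]

end IsDiffeoPath

/-! ### The velocity field of a path of diffeomorphisms -/

theorem eqOn_Icc_of_eqOn_Ioo {X : Type*} [TopologicalSpace X] [T2Space X] {f g : ℝ → X}
    (hf : ContinuousOn f (Icc 0 1)) (hg : ContinuousOn g (Icc 0 1))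
    (hfg : EqOn f g (Ioo (0 : ℝ) 1)) : EqOn f g (Icc (0 : ℝ) 1) :=
  hfg.of_subset_closure hf hg Ioo_subset_Icc_self (closure_Ioo zero_ne_one).ge

theorem exists_eq_const_of_hasDerivAt_zero {E : Type*} [NormedAddCommGroup E] [NormedSpace ℝ E]
    {f : ℝ → E} (hf : ContinuousOn f (Icc 0 1)) (hf' : ∀ t ∈ Ioo (0 : ℝ) 1, HasDerivAt f 0 t) :
    ∃ c, ∀ t ∈ Icc (0 : ℝ) 1, f t = c := by
  obtain ⟨c, hc⟩ := isOpen_Ioo.exists_is_const_of_deriv_eq_zero (𝕜 := ℝ) isPreconnected_Ioo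
    (fun t ht => (hf' t ht).differentiableAt.differentiableWithinAt) (fun t ht => (hf' t ht).deriv)
  exact ⟨c, eqOn_Icc_of_eqOn_Ioo hf continuousOn_const hc⟩

theorem IsDiffeo.map_absolutelyContinuous {T : Space d → Space d}
    (hT : IsDiffeo T) {μ : Measure (Space d)} (hμ : μ ≪ volume) : μ.map T ≪ volume := by
  refine Measure.AbsolutelyContinuous.mk fun s hs hs0 => ?_
  obtain ⟨S, hT, hS, hl, hr⟩ := hT.exists_inverse
  rw [Measure.map_apply hT.continuous.measurable hs]
  refine hμ ?_
  have : T ⁻¹' s = S '' s := by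
    ext x
    exact ⟨fun hx => ⟨T x, hx, hl x⟩, by rintro ⟨y, hy, rfl⟩; rwa [mem_preimage, hr]⟩
  rw [this]
  exact addHaar_image_eq_zero_of_differentiableOn_of_addHaar_eq_zero _
    (hS.differentiable one_ne_zero).differentiableOn hs0

namespace IsDiffeoPath

variable {γ : ℝ → Space d → Space d} (h : IsDiffeoPath γ)
include h

/-- Along a trajectory `y` of the velocity field of `γ`, the label `γₜ⁻¹(y(t))` does not depend on
`t`: differentiating `y(t) = γₜ(z(t))` gives `y' = v(t, y) + Dγₜ(z) z'`, hence `z' = 0`. -/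
theorem exists_eq_apply_of_isTrajectory {y : ℝ → Space d} (hy : IsTrajectory (velocity γ) y) :
    ∃ x, ∀ t ∈ Icc (0 : ℝ) 1, y t = γ t x := by
  have hyc : ContinuousOn y (Icc 0 1) := fun t ht => (hy t ht).continuousWithinAt
  obtain ⟨x, hx⟩ := exists_eq_const_of_hasDerivAt_zero (f := fun t => pathInv γ t (y t))
    (h.continuousOn_pathInv.comp (continuousOn_id.prodMk hyc) fun t ht => ⟨ht, mem_univ _⟩) (by
      intro t ht
      have ht' := Ioo_subset_Icc_self ht
      have hnhds := Icc_mem_nhds ht.1 ht.2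
      have hyt := (hy t ht').hasDerivAt hnhds
      have hz : HasDerivAt (fun s => pathInv γ s (y s)) (deriv (fun s => pathInv γ s (y s)) t) t := by
        refine DifferentiableAt.hasDerivAt ?_
        exact ((h.contDiffAt_pathInv ht (y t)).differentiableAt one_ne_zero).comp
          (f := fun s => (s, y s)) t (differentiableAt_id.prodMk hyt.differentiableAt)
      set w := deriv (fun s => pathInv γ s (y s)) t
      set x := pathInv γ t (y t) with hx
      have hfd := (h.hasFDerivWithinAt ht' x).hasFDerivAt (Icc_prod_univ_mem_nhds ht x)
      set L := fderivWithin ℝ (fun p : ℝ × Space d => γ p.1 p.2) (Icc 0 1 ×ˢ univ) (t, x) with hL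
      have h1 : HasDerivAt (fun s => γ s (pathInv γ s (y s))) (L (1, w)) t :=
        hfd.comp_hasDerivAt (f := fun s => (s, pathInv γ s (y s))) t ((hasDerivAt_id t).prodMk hz)
      have h2 : HasDerivAt (fun s => γ s (pathInv γ s (y s))) (velocity γ t (y t)) t := by
        refine hyt.congr_of_eventuallyEq ?_
        filter_upwards [hnhds] with s hs using h.apply_pathInv hs _
      have h3 : L (1, w) = L (1, 0) := by
        rw [h1.unique h2, velocity, h.timeDeriv_eq ht']
      have h4 : L (0, w) = 0 := by
        have : ((1 : ℝ), w) = (1, 0) + (0, w) := by simp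
        rw [this, map_add] at h3
        simpa using h3
      obtain ⟨e, he⟩ := (h.diffeo t ht').hasFDerivAt_equiv x
      have h5 : e w = L (0, w) := by
        have := congrArg (fun A : Space d →L[ℝ] Space d => A w)
          (he.trans (h.hasFDerivAt_space ht' x).fderiv)
        simpa using this
      have : w = 0 := by
        rw [h4] at h5
        simpa using h5
      rwa [this] at hz)
  exact ⟨x, fun t ht => by rw [← hx t ht, h.apply_pathInv ht]⟩

theorem isFlowField_velocity : IsFlowField (velocity γ) where
  continuousOn := h.continuousOn_velocity
  unique := by
    intro y z hy hz s hs hyz t ht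
    obtain ⟨a, ha⟩ := h.exists_eq_apply_of_isTrajectory hy
    obtain ⟨b, hb⟩ := h.exists_eq_apply_of_isTrajectory hz
    rw [ha s hs, hb s hs] at hyz
    rw [ha t ht, hb t ht, (h.diffeo s hs).bijective.1 hyz]
  exists_smooth := by
    intro s hs
    refine ⟨fun t x => γ t (pathInv γ s x), ?_, fun x => ⟨h.apply_pathInv hs x,
      h.isTrajectory_velocity _⟩⟩
    exact h.contDiffOn.comp (f := fun p : ℝ × Space d => (p.1, pathInv γ s p.2))
      (contDiff_fst.prodMk ((h.diffeo s hs).contDiff_invFun.comp contDiff_snd)).contDiffOn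
      fun p hp => ⟨hp.1, mem_univ _⟩

theorem measurable {t : ℝ} (ht : t ∈ Icc (0 : ℝ) 1) : Measurable (γ t) :=
  (h.diffeo t ht).contDiff.continuous.measurable

/-- The push-forwards of a probability measure under a path of diffeomorphisms depend continuously
on time. -/
theorem continuousOn_of_eq_map {ρ₀ : ProbabilityMeasure (Space d)}
    {ρ : ℝ → ProbabilityMeasure (Space d)}
    (hρ : ∀ t ∈ Icc (0 : ℝ) 1, (ρ t : Measure (Space d)) = (ρ₀ : Measure (Space d)).map (γ t)) :
    ContinuousOn ρ (Icc 0 1) := by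
  intro t₀ ht₀
  rw [ContinuousWithinAt, ProbabilityMeasure.tendsto_iff_forall_integral_tendsto]
  intro f
  have hint : ∀ t ∈ Icc (0 : ℝ) 1,
      ∫ x, f x ∂(ρ t : Measure (Space d)) = ∫ x, f (γ t x) ∂(ρ₀ : Measure (Space d)) := by
    intro t ht
    rw [hρ t ht, integral_map (h.measurable ht).aemeasurable
      f.continuous.measurable.aestronglyMeasurable]
  rw [hint t₀ ht₀]
  refine Tendsto.congr' (f₁ := fun t => ∫ x, f (γ t x) ∂(ρ₀ : Measure (Space d))) ?_ ?_
  · filter_upwards [self_mem_nhdsWithin] with t ht using (hint t ht).symm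
  refine tendsto_integral_filter_of_dominated_convergence (fun _ => ‖f‖) ?_ ?_
    (integrable_const _) ?_
  · filter_upwards [self_mem_nhdsWithin] with t ht
    exact (f.continuous.measurable.comp (h.measurable ht)).aestronglyMeasurable
  · exact Eventually.of_forall fun t => Eventually.of_forall fun x => f.norm_coe_le_norm _
  · refine Eventually.of_forall fun x => ?_
    exact f.continuous.continuousAt.tendsto.comp
      (h.hasDerivWithinAt_timeDeriv ht₀ x).continuousWithinAt

/-- The push-forwards of a measure under `γ` solve the continuity equation: tested against `φ`, it
is the integral over `ρ₀` of `φ(1, γ₁(x)) - φ(0, γ₀(x)) = 0`. -/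
theorem continuityEquation_velocity {ρ₀ : ProbabilityMeasure (Space d)}
    {ρ : ℝ → ProbabilityMeasure (Space d)}
    (hρ : ∀ t ∈ Icc (0 : ℝ) 1, (ρ t : Measure (Space d)) = (ρ₀ : Measure (Space d)).map (γ t)) :
    ContinuityEquation ρ (velocity γ) := by
  intro φ hφ hφc hφs
  set D : ℝ × Space d → ℝ := fun p => fderiv ℝ φ p (1, velocity γ p.1 p.2) with hD
  have hDc : ContinuousOn D (Icc 0 1 ×ˢ univ) :=
    (hφ.continuous_fderiv one_ne_zero).continuousOn.clm_apply
      (continuousOn_const.prodMk h.continuousOn_velocity)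
  obtain ⟨C, hC⟩ : ∃ C, ∀ p, ‖D p‖ ≤ C := by
    obtain ⟨C, hC⟩ := hφc.isCompact.exists_bound_of_continuousOn (hDc.mono
      (hφs.trans (prod_mono Ioo_subset_Icc_self Subset.rfl)))
    refine ⟨max C 0, fun p => ?_⟩
    by_cases hp : p ∈ tsupport φ
    · exact (hC p hp).trans (le_max_left _ _)
    · have : fderiv ℝ φ p = 0 := by
        by_contra hne
        exact hp (support_fderiv_subset ℝ hne)
      simp [hD, this]
  have hDγ : ∀ t ∈ Icc (0 : ℝ) 1, ∫ x, D (t, x) ∂(ρ t : Measure (Space d)) =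
      ∫ x, D (t, γ t x) ∂(ρ₀ : Measure (Space d)) := by
    intro t ht
    rw [hρ t ht, integral_map (h.measurable ht).aemeasurable]
    refine Continuous.aestronglyMeasurable ?_
    exact hDc.comp_continuous (f := fun x => (t, x)) (by fun_prop) fun x => ⟨ht, mem_univ x⟩
  have hDγc : ContinuousOn (fun p : ℝ × Space d => D (p.1, γ p.1 p.2)) (Icc 0 1 ×ˢ univ) :=
    hDc.comp (continuousOn_fst.prodMk h.contDiffOn.continuousOn) fun p hp => ⟨hp.1, mem_univ _⟩
  have hinner : ∀ x, ∫ t in (0 : ℝ)..1, D (t, γ t x) = 0 := by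
    intro x
    have hcont : ContinuousOn (fun t : ℝ => D (t, γ t x)) (Icc 0 1) :=
      hDγc.comp (f := fun t : ℝ => (t, x)) (by fun_prop) fun t ht => ⟨ht, mem_univ x⟩
    have hzero : ∀ t : ℝ, t ∉ Ioo (0 : ℝ) 1 → φ (t, γ t x) = 0 := fun t ht =>
      image_eq_zero_of_notMem_tsupport fun hmem => ht (hφs hmem).1
    rw [intervalIntegral.integral_eq_sub_of_hasDerivAt_of_le (f := fun t => φ (t, γ t x))
      zero_le_one, hzero 1 (by simp), hzero 0 (by simp), sub_zero]
    · exact hφ.continuous.comp_continuousOn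
        (continuousOn_id.prodMk fun t ht => (h.hasDerivWithinAt_timeDeriv ht x).continuousWithinAt)
    · intro t ht
      have h1 := (h.isTrajectory_velocity x t (Ioo_subset_Icc_self ht)).hasDerivAt
        (Icc_mem_nhds ht.1 ht.2)
      exact ((hφ.differentiable one_ne_zero) (t, γ t x)).hasFDerivAt.comp_hasDerivAt
        (f := fun s => (s, γ s x)) t ((hasDerivAt_id t).prodMk h1)
    · exact hcont.intervalIntegrable_of_Icc zero_le_one
  have hswap : Integrable (Function.uncurry fun (t : ℝ) (x : Space d) => D (t, γ t x))
      (((volume : Measure ℝ).restrict (Ioc 0 1)).prod (ρ₀ : Measure (Space d))) := by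
    refine Integrable.of_bound ?_ C (Eventually.of_forall fun p => hC _)
    have := ContinuousOn.aestronglyMeasurable (μ := (volume : Measure ℝ).prod
      (ρ₀ : Measure (Space d))) (hDγc.mono (prod_mono Ioc_subset_Icc_self Subset.rfl))
      (measurableSet_Ioc.prod MeasurableSet.univ)
    rwa [← Measure.prod_restrict, Measure.restrict_univ] at this
  calc ∫ t in (0 : ℝ)..1, ∫ x, D (t, x) ∂(ρ t : Measure (Space d))
      = ∫ t in (0 : ℝ)..1, ∫ x, D (t, γ t x) ∂(ρ₀ : Measure (Space d)) := by
        refine intervalIntegral.integral_congr fun t ht => hDγ t ?_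
        rwa [uIcc_of_le zero_le_one] at ht
    _ = ∫ x, (∫ t in (0 : ℝ)..1, D (t, γ t x)) ∂(ρ₀ : Measure (Space d)) := by
        simp only [intervalIntegral.integral_of_le zero_le_one]
        exact integral_integral_swap hswap
    _ = 0 := by simp [hinner]

end IsDiffeoPath

theorem IsFlowPath.isDiffeoPath {ρ₀ : ProbabilityMeasure (Space d)}
    {π : Measure (Space d × Space d)} {γ : ℝ → Space d → Space d} (h : IsFlowPath ρ₀ π γ) :
    IsDiffeoPath γ :=
  ⟨h.contDiffOn, h.diffeo⟩

theorem IsDiffeoPath.exists_eq_map {γ : ℝ → Space d → Space d} (h : IsDiffeoPath γ)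
    (ρ₀ : ProbabilityMeasure (Space d)) : ∃ ρ : ℝ → ProbabilityMeasure (Space d),
    ∀ t ∈ Icc (0 : ℝ) 1, (ρ t : Measure (Space d)) = (ρ₀ : Measure (Space d)).map (γ t) := by
  classical
  refine ⟨fun t => if ht : t ∈ Icc (0 : ℝ) 1 then ρ₀.map (h.measurable ht).aemeasurable else ρ₀,
    fun t ht => ?_⟩
  simp only [dif_pos ht]
  rfl

theorem IsFlowPath.exists_isAdmissible {ρ₀ ρ₁ : ProbabilityMeasure (Space d)}
    (hρ₀ : (ρ₀ : Measure (Space d)) ≪ volume) {π : Measure (Space d × Space d)}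
    (hπ : π ∈ couplings ρ₀ ρ₁) {γ : ℝ → Space d → Space d} (h : IsFlowPath ρ₀ π γ) :
    ∃ ρ, IsAdmissible ρ₀ ρ₁ ρ (velocity γ) ∧ Corresponds ρ₀ ρ (velocity γ) γ := by
  have hγ := h.isDiffeoPath
  obtain ⟨ρ, hρ⟩ := hγ.exists_eq_map ρ₀
  have h0 : (0 : ℝ) ∈ Icc (0 : ℝ) 1 := left_mem_Icc.2 zero_le_one
  have h1 : (1 : ℝ) ∈ Icc (0 : ℝ) 1 := right_mem_Icc.2 zero_le_one
  refine ⟨ρ, ⟨hγ.isFlowField_velocity, hγ.continuousOn_of_eq_map hρ, fun t ht => ?_,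
    hγ.continuityEquation_velocity hρ, ?_, ?_⟩, fun x => ⟨h.initial x, hγ.isTrajectory_velocity x⟩,
    hρ⟩
  · rw [hρ t ht]
    exact (h.diffeo t ht).map_absolutelyContinuous hρ₀
  · apply Subtype.ext
    have : γ 0 = id := funext h.initial
    change (ρ 0 : Measure (Space d)) = ρ₀
    rw [hρ 0 h0, this, Measure.map_id]
  · apply Subtype.ext
    change (ρ 1 : Measure (Space d)) = ρ₁
    rw [hρ 1 h1, ← hπ.2, ← h.coupling, Measure.map_map measurable_snd
      ((hγ.measurable h0).prodMk (hγ.measurable h1))]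
    rfl

/-! ### Weak derivatives, test functions and weak continuity -/

/-- The primitive of a continuous function with integral zero whose support lies in `(0, 1)` is a
`C¹` function whose support lies in `(0, 1)`. -/
theorem exists_primitive {η : ℝ → ℝ} (hη : Continuous η) (hηc : HasCompactSupport η)
    (hηs : tsupport η ⊆ Ioo 0 1) (hη0 : ∫ t, η t = 0) :
    ∃ χ : ℝ → ℝ, ContDiff ℝ 1 χ ∧ HasCompactSupport χ ∧ tsupport χ ⊆ Ioo 0 1 ∧ deriv χ = η := by
  obtain ⟨a, b, ha, hb, hab⟩ : ∃ a b : ℝ, 0 < a ∧ b < 1 ∧ tsupport η ⊆ Icc a b := by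
    set K := insert (1 / 2 : ℝ) (tsupport η) with hK
    have hKc : IsCompact K := hηc.isCompact.insert _
    have hKne : K.Nonempty := insert_nonempty _ _
    have hKs : K ⊆ Ioo (0 : ℝ) 1 := insert_subset (by norm_num) hηs
    exact ⟨sInf K, sSup K, (hKs (hKc.sInf_mem hKne)).1, (hKs (hKc.sSup_mem hKne)).2,
      fun x hx => ⟨csInf_le hKc.bddBelow (mem_insert_of_mem _ hx),
        le_csSup hKc.bddAbove (mem_insert_of_mem _ hx)⟩⟩
  have hzero : ∀ x, x ∉ Icc a b → η x = 0 := fun x hx =>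
    image_eq_zero_of_notMem_tsupport fun h => hx (hab h)
  have hderiv : deriv (fun t => ∫ x in (0 : ℝ)..t, η x) = η := by
    funext t
    exact hη.deriv_integral _ _ _
  have hsupp : ∀ t, t ∉ Icc a b → ∫ x in (0 : ℝ)..t, η x = 0 := by
    intro t ht
    rcases lt_or_ge t a with hta | hta
    · refine intervalIntegral.integral_zero_ae (Eventually.of_forall fun x hx => ?_)
      exact hzero x fun h => not_lt.2 h.1 (lt_of_le_of_lt hx.2 (max_lt ha hta))
    · have hbt : b < t := not_le.1 fun h => ht ⟨hta, h⟩
      rw [intervalIntegral.integral_eq_integral_of_support_subset, hη0]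
      intro x hx
      by_contra hxt
      exact hx (hzero x fun h => hxt ⟨ha.trans_le h.1, h.2.trans hbt.le⟩)
  have htsupp : tsupport (fun t => ∫ x in (0 : ℝ)..t, η x) ⊆ Icc a b :=
    closure_minimal (fun t ht => by_contra fun h => ht (hsupp t h)) isClosed_Icc
  refine ⟨fun t => ∫ x in (0 : ℝ)..t, η x, ?_, isCompact_Icc.of_isClosed_subset
    (isClosed_tsupport _) htsupp, htsupp.trans fun t ht => ⟨ha.trans_le ht.1, ht.2.trans_lt hb⟩,
    hderiv⟩
  rw [contDiff_one_iff_deriv, hderiv]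
  exact ⟨fun t => (intervalIntegral.integral_hasDerivAt_right (hη.intervalIntegrable _ _)
    hη.stronglyMeasurable.stronglyMeasurableAtFilter hη.continuousAt).differentiableAt, hη⟩

/-- The lemma of du Bois-Reymond: a continuous function on `[0, 1]` with vanishing weak derivative
is constant. -/
theorem exists_eq_const_of_integral_deriv_mul_eq_zero {g : ℝ → ℝ} (hg : ContinuousOn g (Icc 0 1))
    (h : ∀ χ : ℝ → ℝ, ContDiff ℝ 1 χ → HasCompactSupport χ → tsupport χ ⊆ Ioo 0 1 →
      ∫ t in (0 : ℝ)..1, deriv χ t * g t = 0) : ∃ c, ∀ t ∈ Icc (0 : ℝ) 1, g t = c := by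
  obtain ⟨η₀, hη₀, hη₀c, hη₀s, hη₀1⟩ : ∃ η₀ : ℝ → ℝ, Continuous η₀ ∧ HasCompactSupport η₀ ∧
      tsupport η₀ ⊆ Ioo 0 1 ∧ ∫ t, η₀ t = 1 := by
    let f : ContDiffBump (1 / 2 : ℝ) := ⟨1 / 8, 1 / 4, by norm_num, by norm_num⟩
    refine ⟨f.normed volume, f.continuous_normed, f.hasCompactSupport_normed, ?_,
      f.integral_normed⟩
    rw [f.tsupport_normed_eq, Real.closedBall_eq_Icc]
    exact fun t ht => ⟨by have := ht.1; norm_num [f] at this; linarith,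
      by have := ht.2; norm_num [f] at this; linarith⟩
  have hint : ∀ η : ℝ → ℝ, Continuous η →
      IntervalIntegrable (fun t => η t * g t) volume 0 1 := fun η hη =>
    (hη.continuousOn.mul hg).intervalIntegrable_of_Icc zero_le_one
  set c := ∫ t in (0 : ℝ)..1, η₀ t * g t with hc
  refine ⟨c, ?_⟩
  have hgc : ContinuousOn (fun t => g t - c) (Icc 0 1) := hg.sub continuousOn_const
  have hae : ∀ᵐ t, t ∈ Ioo (0 : ℝ) 1 → g t - c = 0 := by
    refine isOpen_Ioo.ae_eq_zero_of_integral_contDiff_smul_eq_zero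
      ((hgc.mono Ioo_subset_Icc_self).locallyIntegrableOn measurableSet_Ioo) ?_
    intro η hη hηc hηs
    have hηcont := hη.continuous
    have hsub : ∀ f : ℝ → ℝ, ∫ t, η t * f t = ∫ t in (0 : ℝ)..1, η t * f t := by
      intro f
      refine (intervalIntegral.integral_eq_integral_of_support_subset ?_).symm
      exact (Function.support_mul_subset_left _ _).trans
        ((subset_tsupport _).trans (hηs.trans Ioo_subset_Ioc_self))
    set m := ∫ t, η t with hm
    have hm' : ∫ t in (0 : ℝ)..1, η t = m := by simpa using (hsub 1).symm
    -- `η - (∫ η) η₀` has integral zero, hence is the derivative of a test function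
    obtain ⟨χ, hχ, hχc, hχs, hχd⟩ := exists_primitive (η := fun t => η t - m * η₀ t)
      (hηcont.sub (continuous_const.mul hη₀)) (hηc.sub hη₀c.mul_left)
      ((tsupport_sub _ _).trans (union_subset hηs ((tsupport_mul_subset_right).trans hη₀s))) (by
        rw [integral_sub (hηcont.integrable_of_hasCompactSupport hηc)
          ((hη₀.integrable_of_hasCompactSupport hη₀c).const_mul m), integral_const_mul, hη₀1]
        simp [hm])
    have h0 := h χ hχ hχc hχs
    rw [hχd] at h0
    have h1 : ∫ t in (0 : ℝ)..1, (η t - m * η₀ t) * g t =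
        (∫ t in (0 : ℝ)..1, η t * g t) - m * c := by
      rw [hc, ← intervalIntegral.integral_const_mul,
        ← intervalIntegral.integral_sub (hint η hηcont) ((hint η₀ hη₀).const_mul m)]
      refine intervalIntegral.integral_congr fun t _ => ?_
      ring
    simp only [smul_eq_mul]
    rw [hsub]
    have h2 : ∫ t in (0 : ℝ)..1, η t * (g t - c) = (∫ t in (0 : ℝ)..1, η t * g t) - m * c := by
      rw [← hm', ← intervalIntegral.integral_mul_const, ← intervalIntegral.integral_sub
        (hint η hηcont) (Continuous.intervalIntegrable (u := fun t => η t * c) (by fun_prop) _ _)]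
      refine intervalIntegral.integral_congr fun t _ => ?_
      ring
    rw [h2, ← h1, h0]
  have hIoo : EqOn g (fun _ => c) (Ioo 0 1) := by
    refine Measure.eqOn_open_of_ae_eq (μ := volume) ?_ isOpen_Ioo
      (hg.mono Ioo_subset_Icc_self) continuousOn_const
    rw [EventuallyEq, ae_restrict_iff' measurableSet_Ioo]
    filter_upwards [hae] with t ht hmem using sub_eq_zero.1 (ht hmem)
  exact eqOn_Icc_of_eqOn_Ioo hg continuousOn_const hIoo

/-- Finite measures are determined by the integrals of `C¹` compactly supported functions. -/
theorem measure_ext_of_integral_contDiff {E : Type*} [NormedAddCommGroup E] [NormedSpace ℝ E]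
    [FiniteDimensional ℝ E] [MeasurableSpace E] [BorelSpace E] {μ ν : Measure E}
    [IsFiniteMeasure μ] [IsFiniteMeasure ν]
    (h : ∀ ψ : E → ℝ, ContDiff ℝ 1 ψ → HasCompactSupport ψ → ∫ x, ψ x ∂μ = ∫ x, ψ x ∂ν) :
    μ = ν := by
  obtain ⟨m, hm, hμ, hν⟩ : ∃ m : Measure E, IsFiniteMeasure m ∧ μ ≪ m ∧ ν ≪ m :=
    ⟨μ + ν, inferInstance, Measure.AbsolutelyContinuous.rfl.add_right ν,
      Measure.absolutelyContinuous_of_le (Measure.le_add_left le_rfl)⟩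
  have hμi : Integrable (fun x => (μ.rnDeriv m x).toReal) m := Measure.integrable_toReal_rnDeriv
  have hνi : Integrable (fun x => (ν.rnDeriv m x).toReal) m := Measure.integrable_toReal_rnDeriv
  have hae : ∀ᵐ x ∂m, (μ.rnDeriv m x).toReal = (ν.rnDeriv m x).toReal := by
    refine ae_eq_of_integral_contDiff_smul_eq hμi.locallyIntegrable hνi.locallyIntegrable ?_
    intro ψ hψ hψc
    have h1 := h ψ (hψ.of_le (by exact_mod_cast le_top)) hψc
    have h2 := integral_rnDeriv_smul (f := ψ) hμ
    have h3 := integral_rnDeriv_smul (f := ψ) hν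
    simp only [smul_eq_mul] at h2 h3 ⊢
    simp only [mul_comm (ψ _)]
    rw [h2, h3, h1]
  rw [← Measure.withDensity_rnDeriv_eq μ m hμ, ← Measure.withDensity_rnDeriv_eq ν m hν]
  refine withDensity_congr_ae ?_
  filter_upwards [hae, μ.rnDeriv_lt_top m, ν.rnDeriv_lt_top m] with x hx h1 h2
  exact (ENNReal.toReal_eq_toReal_iff' h1.ne h2.ne).1 hx

/-- If `ρ` is weakly continuous in time and `Ψ` is continuous and vanishes outside a compact set,
uniformly in time, then the integral of `Ψ t` with respect to `ρ t` is continuous in time. -/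
theorem continuousOn_integral_of_compact {ρ : ℝ → ProbabilityMeasure (Space d)}
    (hρ : ContinuousOn ρ (Icc 0 1)) {Ψ : ℝ → Space d → ℝ}
    (hΨ : ContinuousOn (fun p : ℝ × Space d => Ψ p.1 p.2) (Icc 0 1 ×ˢ univ)) {K : Set (Space d)}
    (hK : IsCompact K) (hΨK : ∀ t ∈ Icc (0 : ℝ) 1, ∀ x, x ∉ K → Ψ t x = 0) :
    ContinuousOn (fun t => ∫ x, Ψ t x ∂(ρ t : Measure (Space d))) (Icc 0 1) := by
  have hslice : ∀ t ∈ Icc (0 : ℝ) 1, Continuous (Ψ t) := fun t ht =>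
    hΨ.comp_continuous (f := fun x => (t, x)) (by fun_prop) fun x => ⟨ht, mem_univ x⟩
  have hsupp : ∀ t ∈ Icc (0 : ℝ) 1, HasCompactSupport (Ψ t) := fun t ht =>
    HasCompactSupport.intro hK fun x hx => hΨK t ht x hx
  have hint : ∀ t ∈ Icc (0 : ℝ) 1, ∀ μ : ProbabilityMeasure (Space d),
      Integrable (Ψ t) (μ : Measure (Space d)) := fun t ht μ =>
    (hslice t ht).integrable_of_hasCompactSupport (hsupp t ht)
  intro t₀ ht₀
  have h1 : Tendsto (fun t => ∫ x, Ψ t₀ x ∂(ρ t : Measure (Space d))) (𝓝[Icc 0 1] t₀)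
      (𝓝 (∫ x, Ψ t₀ x ∂(ρ t₀ : Measure (Space d)))) := by
    obtain ⟨C, hC⟩ := (hslice t₀ ht₀).bounded_above_of_compact_support (hsupp t₀ ht₀)
    exact ProbabilityMeasure.tendsto_iff_forall_integral_tendsto.1 (hρ t₀ ht₀)
      (BoundedContinuousFunction.ofNormedAddCommGroup (Ψ t₀) (hslice t₀ ht₀) C hC)
  have h2 : Tendsto (fun t => ∫ x, (Ψ t x - Ψ t₀ x) ∂(ρ t : Measure (Space d)))
      (𝓝[Icc 0 1] t₀) (𝓝 0) := by
    rw [Metric.tendsto_nhds]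
    intro ε hε
    obtain ⟨v, hv, hv'⟩ := hK.mem_uniformity_of_prod (f := Ψ) (q := t₀)
      (hΨ.mono (prod_mono Subset.rfl (subset_univ K))) ht₀ (Metric.dist_mem_uniformity (half_pos hε))
    filter_upwards [hv, self_mem_nhdsWithin] with t htv ht
    rw [dist_zero_right]
    refine lt_of_le_of_lt (norm_integral_le_of_norm_le_const (C := ε / 2)
      (Eventually.of_forall fun x => ?_)) (by simpa using hε)
    by_cases hx : x ∈ K
    · have := hv' t htv x hx
      rw [← dist_eq_norm]
      exact le_of_lt this
    · rw [hΨK t ht x hx, hΨK t₀ ht₀ x hx, sub_zero, norm_zero]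
      exact (half_pos hε).le
  have h3 := h2.add h1
  rw [zero_add] at h3
  refine h3.congr' ?_
  filter_upwards [self_mem_nhdsWithin] with t ht
  rw [integral_sub (hint t ht _) (hint t₀ ht₀ _), sub_add_cancel]

/-! ### Flow fields and uniqueness for the continuity equation -/

/-- The flow of a flow field, started at time `0`, is a path of diffeomorphisms. The inverse of the
flow map at time `t` is the value at time `0` of the flow started at time `t`. -/
theorem IsFlowField.exists_isDiffeoPath {v : ℝ → Space d → Space d} (hv : IsFlowField v) :
    ∃ γ, IsDiffeoPath γ ∧ ∀ x, γ 0 x = x ∧ IsTrajectory v (fun t => γ t x) := by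
  have h0 : (0 : ℝ) ∈ Icc (0 : ℝ) 1 := left_mem_Icc.2 zero_le_one
  have hslice : ∀ Y : ℝ → Space d → Space d, ∀ t ∈ Icc (0 : ℝ) 1,
      ContDiffOn ℝ 1 (fun p : ℝ × Space d => Y p.1 p.2) (Icc 0 1 ×ˢ univ) →
      ContDiff ℝ 1 (Y t) := fun Y t ht hY =>
    contDiffOn_univ.1 (hY.comp (f := fun x : Space d => (t, x))
      (contDiff_const.prodMk contDiff_id).contDiffOn fun x _ => ⟨ht, mem_univ x⟩)
  obtain ⟨γ, hγ, hγt⟩ := hv.exists_smooth 0 h0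
  refine ⟨γ, ⟨hγ, fun t ht => ?_⟩, hγt⟩
  obtain ⟨Y, hY, hYt⟩ := hv.exists_smooth t ht
  refine isDiffeo_of_inverse (hslice γ t ht hγ) (hslice Y 0 h0 hY) (fun x => ?_) (fun y => ?_)
  · have := hv.unique _ _ (hYt (γ t x)).2 (hγt x).2 t ht (hYt (γ t x)).1 h0
    exact this.trans (hγt x).1
  · have := hv.unique _ _ (hγt (Y 0 y)).2 (hYt y).2 0 h0 (hγt (Y 0 y)).1 ht
    exact this.trans (hYt y).1

namespace IsDiffeoPath

variable {γ : ℝ → Space d → Space d} (h : IsDiffeoPath γ)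
include h

theorem isCompact_image_prod {I : Set ℝ} (hI : IsCompact I)
    (hIs : I ⊆ Icc (0 : ℝ) 1) {K : Set (Space d)} (hK : IsCompact K) :
    IsCompact ((fun p : ℝ × Space d => (p.1, γ p.1 p.2)) '' (I ×ˢ K)) :=
  (hI.prod hK).image_of_continuousOn (continuousOn_fst.prodMk
    (h.contDiffOn.continuousOn.mono (prod_mono hIs (subset_univ K))))

theorem det_fderiv_pos (h0 : ∀ x, γ 0 x = x) {t : ℝ} (ht : t ∈ Icc (0 : ℝ) 1) (x : Space d) :
    0 < (fderiv ℝ (γ t) x).det := by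
  have hcont : ContinuousOn (fun s => (fderiv ℝ (γ s) x).det) (Icc 0 1) :=
    ContinuousLinearMap.continuous_det.comp_continuousOn
      (h.continuousOn_fderiv_space.comp (f := fun s : ℝ => (s, x)) (by fun_prop)
        fun s hs => ⟨hs, mem_univ x⟩)
  by_contra hneg
  have hone : (fderiv ℝ (γ 0) x).det = 1 := by
    have : γ 0 = id := funext h0
    rw [this, fderiv_id]
    exact LinearMap.det_id
  obtain ⟨s, hs, hs0⟩ := intermediate_value_Icc' ht.1
    (hcont.mono (Icc_subset_Icc le_rfl ht.2)) ⟨not_lt.1 hneg, hone.symm ▸ zero_le_one⟩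
  obtain ⟨e, he⟩ := (h.diffeo s ⟨hs.1, hs.2.trans ht.2⟩).hasFDerivAt_equiv x
  simp only [← he] at hs0
  exact (LinearEquiv.isUnit_det' e.toLinearEquiv).ne_zero hs0

/-- Transporting a test function `ψ` along the flow gives the test function
`φ(t, x) = χ(t) ψ(γₜ⁻¹(x))` of the continuity equation, whose derivative along the flow is
`χ'(t) ψ(γₜ⁻¹(x))`. -/
theorem integral_deriv_mul_eq_zero {v : ℝ → Space d → Space d}
    (hv : ∀ x, IsTrajectory v (fun t => γ t x)) {ρ : ℝ → ProbabilityMeasure (Space d)}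
    (hce : ContinuityEquation ρ v) {ψ : Space d → ℝ} (hψ : ContDiff ℝ 1 ψ)
    (hψc : HasCompactSupport ψ) {χ : ℝ → ℝ} (hχ : ContDiff ℝ 1 χ) (hχc : HasCompactSupport χ)
    (hχs : tsupport χ ⊆ Ioo 0 1) :
    ∫ t in (0 : ℝ)..1, deriv χ t * ∫ x, ψ (pathInv γ t x) ∂(ρ t : Measure (Space d)) = 0 := by
  set φ : ℝ × Space d → ℝ := fun p => χ p.1 * ψ (pathInv γ p.1 p.2) with hφ
  have hK := h.isCompact_image_prod hχc.isCompact (hχs.trans Ioo_subset_Icc_self) hψc.isCompact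
  set K := (fun p : ℝ × Space d => (p.1, γ p.1 p.2)) '' (tsupport χ ×ˢ tsupport ψ)
  have hφK : tsupport φ ⊆ K := by
    refine closure_minimal (fun p hp => ?_) hK.isClosed
    have h1 : p.1 ∈ tsupport χ := subset_tsupport _ (left_ne_zero_of_mul hp)
    have h2 : pathInv γ p.1 p.2 ∈ tsupport ψ := subset_tsupport _ (right_ne_zero_of_mul hp)
    exact ⟨(p.1, pathInv γ p.1 p.2), ⟨h1, h2⟩,
      Prod.ext rfl (h.apply_pathInv (Ioo_subset_Icc_self (hχs h1)) p.2)⟩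
  have hφs : tsupport φ ⊆ Ioo (0 : ℝ) 1 ×ˢ univ := by
    refine hφK.trans ?_
    rintro _ ⟨p, hp, rfl⟩
    exact ⟨hχs hp.1, mem_univ _⟩
  have hφd : ∀ t ∈ Ioo (0 : ℝ) 1, ∀ x, ContDiffAt ℝ 1 φ (t, x) := fun t ht x =>
    (hχ.contDiffAt.comp (t, x) contDiffAt_fst).mul
      (hψ.contDiffAt.comp (t, x) (h.contDiffAt_pathInv ht x))
  have hφ1 : ContDiff ℝ 1 φ := by
    rw [contDiff_iff_contDiffAt]
    rintro ⟨t, x⟩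
    by_cases hp : (t, x) ∈ tsupport φ
    · exact hφd t (hφs hp).1 x
    · exact (contDiffAt_const (c := (0 : ℝ))).congr_of_eventuallyEq
        (notMem_tsupport_iff_eventuallyEq.1 hp)
  have hmain := hce φ hφ1 (hK.of_isClosed_subset (isClosed_tsupport _) hφK) hφs
  refine Eq.trans ?_ hmain
  refine intervalIntegral.integral_congr fun t _ => ?_
  rw [← integral_const_mul]
  congr 1
  funext x
  by_cases ht : t ∈ Ioo (0 : ℝ) 1
  · have ht' := Ioo_subset_Icc_self ht
    have hx := h.apply_pathInv ht' x
    set z := pathInv γ t x with hz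
    -- along the trajectory through `(t, x)` the function `φ` is `s ↦ χ(s) ψ(z)`
    have h1 : HasDerivAt (fun s => φ (s, γ s z)) (deriv χ t * ψ z) t := by
      refine (((hχ.differentiable one_ne_zero) t).hasDerivAt.mul_const (ψ z)).congr_of_eventuallyEq
        ?_
      filter_upwards [Icc_mem_nhds ht.1 ht.2] with s hs
      simp only [hφ]
      rw [h.pathInv_apply hs]
    have h2 : HasDerivAt (fun s => γ s z) (v t x) t := by
      have : HasDerivAt (fun s => γ s z) (v t (γ t z)) t :=
        (hv z t ht').hasDerivAt (Icc_mem_nhds ht.1 ht.2)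
      rwa [hx] at this
    have h3 : HasFDerivAt φ (fderiv ℝ φ (t, x)) (t, γ t z) := by
      rw [hx]
      exact ((hφ1.differentiable one_ne_zero) (t, x)).hasFDerivAt
    exact h1.unique (h3.comp_hasDerivAt (f := fun s => (s, γ s z)) t
      ((hasDerivAt_id t).prodMk h2))
  · have h1 : deriv χ t = 0 := by
      by_contra hne
      exact ht (hχs (support_deriv_subset hne))
    have h2 : fderiv ℝ φ (t, x) = 0 := by
      by_contra hne
      exact ht (hφs (support_fderiv_subset ℝ hne)).1
    rw [h1, h2, zero_mul]
    rfl

/-- Uniqueness for the continuity equation: a weakly continuous solution is transported by the flow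
of the velocity field. -/
theorem eq_map_of_continuityEquation {v : ℝ → Space d → Space d}
    (h0 : ∀ x, γ 0 x = x) (hv : ∀ x, IsTrajectory v (fun t => γ t x))
    {ρ : ℝ → ProbabilityMeasure (Space d)} (hρ : ContinuousOn ρ (Icc 0 1))
    (hce : ContinuityEquation ρ v) {t : ℝ} (ht : t ∈ Icc (0 : ℝ) 1) :
    (ρ t : Measure (Space d)) = (ρ 0 : Measure (Space d)).map (γ t) := by
  have h0mem : (0 : ℝ) ∈ Icc (0 : ℝ) 1 := left_mem_Icc.2 zero_le_one
  have hinv0 : pathInv γ 0 = id := funext fun x => by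
    have := h.pathInv_apply h0mem x
    rwa [h0 x] at this
  have hinvm : Measurable (pathInv γ t) :=
    (h.diffeo t ht).contDiff_invFun.continuous.measurable
  have key : (ρ t : Measure (Space d)).map (pathInv γ t) = ρ 0 := by
    have := Measure.isProbabilityMeasure_map (μ := (ρ t : Measure (Space d))) hinvm.aemeasurable
    refine measure_ext_of_integral_contDiff fun ψ hψ hψc => ?_
    rw [integral_map hinvm.aemeasurable hψ.continuous.measurable.aestronglyMeasurable]
    have hK := (h.isCompact_image_prod isCompact_Icc Subset.rfl hψc.isCompact).image continuous_snd
    obtain ⟨c, hc⟩ := exists_eq_const_of_integral_deriv_mul_eq_zero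
      (continuousOn_integral_of_compact hρ (Ψ := fun t x => ψ (pathInv γ t x))
        (hψ.continuous.comp_continuousOn h.continuousOn_pathInv) hK (by
          intro s hs x hx
          by_contra hne
          exact hx ⟨_, ⟨(s, pathInv γ s x), ⟨hs, subset_tsupport _ hne⟩, rfl⟩,
            h.apply_pathInv hs x⟩))
      (fun χ hχ hχc hχs => h.integral_deriv_mul_eq_zero hv hce hψ hψc hχ hχc hχs)
    rw [hc t ht, ← hc 0 h0mem, hinv0]
    rfl
  rw [← key, Measure.map_map (h.measurable ht) hinvm]
  have : γ t ∘ pathInv γ t = id := funext fun x => h.apply_pathInv ht x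
  rw [this, Measure.map_id]

end IsDiffeoPath

/-- The flow of an admissible velocity field induces a diffeomorphic coupling. -/
theorem IsAdmissible.exists_isFlowPath {ρ₀ ρ₁ : ProbabilityMeasure (Space d)}
    {ρ : ℝ → ProbabilityMeasure (Space d)} {v : ℝ → Space d → Space d}
    (h : IsAdmissible ρ₀ ρ₁ ρ v) :
    ∃ π ∈ diffeoCouplings ρ₀ ρ₁, ∃ γ, IsFlowPath ρ₀ π γ ∧ Corresponds ρ₀ ρ v γ := by
  obtain ⟨γ, hγ, hγv⟩ := h.flowField.exists_isDiffeoPath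
  have h0 : (0 : ℝ) ∈ Icc (0 : ℝ) 1 := left_mem_Icc.2 zero_le_one
  have h1 : (1 : ℝ) ∈ Icc (0 : ℝ) 1 := right_mem_Icc.2 zero_le_one
  have hρ : ∀ t ∈ Icc (0 : ℝ) 1,
      (ρ t : Measure (Space d)) = (ρ₀ : Measure (Space d)).map (γ t) := fun t ht => by
    rw [← h.initial]
    exact hγ.eq_map_of_continuityEquation (fun x => (hγv x).1) (fun x => (hγv x).2)
      h.continuousOn h.continuityEquation ht
  have hm := hγ.measurable h1
  have hmap : (ρ₀ : Measure (Space d)).map (γ 1) = ρ₁ := by rw [← hρ 1 h1, h.final]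
  refine ⟨(ρ₀ : Measure (Space d)).map (fun x => (x, γ 1 x)), ⟨⟨?_, ?_⟩, γ 1,
    ⟨hγ.diffeo 1 h1, hmap, fun x => hγ.det_fderiv_pos (fun x => (hγv x).1) h1 x⟩, rfl⟩, γ,
    ⟨hγ.contDiffOn, fun x => (hγv x).1, hγ.diffeo, ?_⟩, hγv, hρ⟩
  · rw [Measure.map_map measurable_fst (measurable_id'.prodMk hm)]
    exact Measure.map_id
  · rw [Measure.map_map measurable_snd (measurable_id'.prodMk hm)]
    exact hmap
  · simp only [fun x => (hγv x).1]

/-! ### Splitting the kinetic energy off the action -/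

theorem addTop_coe_nnreal (r : ℝ≥0) (x : EReal) :
    addTop ((r : ℝ≥0∞) : EReal) x = ((r : ℝ) : EReal) + x := by
  have hr : ((r : ℝ≥0∞) : EReal) = ((r : ℝ) : EReal) := rfl
  rw [addTop, hr, EReal.neg_add (Or.inl (by simp [← EReal.coe_neg]))
    (Or.inl (by simp [← EReal.coe_neg])), neg_neg, sub_eq_add_neg, neg_neg]

theorem addTop_top_right (x : EReal) : addTop x ⊤ = ⊤ := by simp [addTop]

theorem addTop_top_left (x : EReal) : addTop ⊤ x = ⊤ := by simp [addTop]

theorem measurable_addTop : Measurable fun p : EReal × EReal => addTop p.1 p.2 :=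
  (measurable_fst.neg.add measurable_snd.neg).neg

/-- Positive and negative parts of a sum with a nonnegative real, arranged without subtraction. -/
theorem toENNReal_add_toENNReal_neg (r : ℝ≥0) (x : EReal) :
    (((r : ℝ) : EReal) + x).toENNReal + (-x).toENNReal =
      (-(((r : ℝ) : EReal) + x)).toENNReal + r + x.toENNReal := by
  induction x with
  | bot => simp
  | top => simp
  | coe x =>
    rw [← EReal.coe_add, ← EReal.coe_neg, ← EReal.coe_neg]
    simp only [EReal.real_coe_toENNReal]
    rw [← ENNReal.ofReal_coe_nnreal (p := r)]
    have hr : (0 : ℝ) ≤ r := r.2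
    have hmax : ∀ y : ℝ, ENNReal.ofReal y = ENNReal.ofReal (max y 0) := fun y => by
      rw [ENNReal.ofReal_max]
      simp
    rw [hmax (r + x), hmax (-x), hmax (-(r + x)), hmax x, ← ENNReal.ofReal_add (by simp) (by simp),
      ← ENNReal.ofReal_add (by simp) hr, ← ENNReal.ofReal_add (by positivity) (by simp)]
    congr 1
    simp only [max_def]
    split_ifs <;> linarith

/-- A nonnegative measurable function `k` with finite integral can be split off from `extIntegral`,
whether or not the remaining integrand is measurable or its integral is defined. -/
theorem extIntegral_addTop {α : Type*} [MeasurableSpace α] {μ : Measure α} {k : α → ℝ≥0∞}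
    (hk : AEMeasurable k μ) (hK : ∫⁻ a, k a ∂μ ≠ ⊤) (f : α → EReal) :
    extIntegral μ (fun a => addTop (k a : EReal) (f a)) =
      addTop ((∫⁻ a, k a ∂μ : ℝ≥0∞) : EReal) (extIntegral μ f) := by
  have hfin : ∀ᵐ a ∂μ, k a ≠ ⊤ := (ae_lt_top' hk hK).mono fun a ha => ha.ne
  have hkE : AEMeasurable (fun a => (k a : EReal)) μ :=
    measurable_coe_ennreal_ereal.comp_aemeasurable hk
  -- where `k` is finite, `f` is recovered from `k + f` by subtraction
  have hmeas : AEMeasurable (fun a => addTop (k a : EReal) (f a)) μ ↔ AEMeasurable f μ := by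
    refine ⟨fun hm => ?_, fun hf => measurable_addTop.comp_aemeasurable (hkE.prodMk hf)⟩
    refine (hm.add hkE.neg).congr ?_
    filter_upwards [hfin] with a ha
    change addTop (k a : EReal) (f a) + -(k a : EReal) = f a
    lift k a to ℝ≥0 using ha with r
    rw [addTop_coe_nnreal]
    exact EReal.add_sub_cancel_left
  by_cases hf : AEMeasurable f μ
  swap
  · rw [extIntegral, extIntegral, if_neg (fun h => hf (hmeas.1 h.1)), if_neg (fun h => hf h.1),
      addTop_top_right]
  have hg := hmeas.2 hf
  have hgneg : AEMeasurable (fun a => -addTop (k a : EReal) (f a)) μ := hg.neg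
  set A := ∫⁻ a, (addTop (k a : EReal) (f a)).toENNReal ∂μ with hA
  set B := ∫⁻ a, (-addTop (k a : EReal) (f a)).toENNReal ∂μ with hB
  set K := ∫⁻ a, k a ∂μ with hKdef
  set P := ∫⁻ a, (f a).toENNReal ∂μ with hP
  set N := ∫⁻ a, (-f a).toENNReal ∂μ with hN
  have hPA : P ≤ A := by
    refine lintegral_mono_ae ?_
    filter_upwards [hfin] with a ha
    lift k a to ℝ≥0 using ha with r
    rw [addTop_coe_nnreal]
    exact EReal.toENNReal_le_toENNReal (le_add_of_nonneg_left (by exact_mod_cast r.2))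
  have hAP : A ≤ K + P := by
    rw [hKdef, hP, ← lintegral_add_left' hk]
    refine lintegral_mono_ae ?_
    filter_upwards [hfin] with a ha
    lift k a to ℝ≥0 using ha with r
    rw [addTop_coe_nnreal]
    refine EReal.toENNReal_add_le.trans ?_
    simp
  have hsum : A + N = B + K + P := by
    rw [hA, hN, ← lintegral_add_left' hg.ereal_toENNReal, hB, hKdef, hP,
      ← lintegral_add_left' hgneg.ereal_toENNReal,
      ← lintegral_add_right' _ hf.ereal_toENNReal]
    refine lintegral_congr_ae ?_
    filter_upwards [hfin] with a ha
    lift k a to ℝ≥0 using ha with r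
    simp only [addTop_coe_nnreal]
    exact toENNReal_add_toENNReal_neg r (f a)
  by_cases hPtop : P = ⊤
  · have hAtop : A = ⊤ := top_le_iff.1 (hPtop ▸ hPA)
    rw [extIntegral, extIntegral, if_neg (fun h => h.2 hAtop), if_neg (fun h => h.2 hPtop),
      addTop_top_right]
  have hAtop : A ≠ ⊤ := ne_top_of_le_ne_top (ENNReal.add_ne_top.2 ⟨hK, hPtop⟩) hAP
  rw [extIntegral, extIntegral, if_pos ⟨hg, hAtop⟩, if_pos ⟨hf, hPtop⟩]
  change (A : EReal) - B = addTop (K : EReal) ((P : EReal) - N)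
  clear_value A B K P N
  lift A to ℝ≥0 using hAtop
  lift K to ℝ≥0 using hK
  lift P to ℝ≥0 using hPtop
  rw [addTop_coe_nnreal]
  induction N with
  | top =>
    have : B = ⊤ := by
      rw [add_top] at hsum
      by_contra hBtop
      exact ENNReal.add_ne_top.2 ⟨ENNReal.add_ne_top.2 ⟨hBtop, ENNReal.coe_ne_top⟩,
        ENNReal.coe_ne_top⟩ hsum.symm
    simp [this]
  | coe N =>
    have hBtop : B ≠ ⊤ := by
      rintro rfl
      simp at hsum
    lift B to ℝ≥0 using hBtop
    have h1 : (A : ℝ) + N = B + K + P := by exact_mod_cast hsum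
    change ((A : ℝ) : EReal) - ((B : ℝ) : EReal) =
      ((K : ℝ) : EReal) + (((P : ℝ) : EReal) - ((N : ℝ) : EReal))
    rw [← EReal.coe_sub, ← EReal.coe_sub, ← EReal.coe_add]
    congr 1
    linarith

theorem extIntegral_congr_ae {α : Type*} [MeasurableSpace α] {μ : Measure α} {f g : α → EReal}
    (h : f =ᵐ[μ] g) : extIntegral μ f = extIntegral μ g := by
  rw [extIntegral, extIntegral, aemeasurable_congr h,
    lintegral_congr_ae (h.mono fun a ha => congrArg EReal.toENNReal ha),
    lintegral_congr_ae (h.mono fun a ha => congrArg (fun x => (-x).toENNReal) ha)]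

/-- The kinetic energy in Eulerian coordinates is the kinetic energy in Lagrangian coordinates. -/
theorem Corresponds.kineticEnergy_eq {ρ₀ : ProbabilityMeasure (Space d)}
    {ρ : ℝ → ProbabilityMeasure (Space d)} {v γ : ℝ → Space d → Space d}
    (hc : Corresponds ρ₀ ρ v γ) (hγ : IsDiffeoPath γ) {t : ℝ} (ht : t ∈ Icc (0 : ℝ) 1) :
    kineticEnergy ρ v t = ∫⁻ x, ‖timeDeriv γ t x‖ₑ ^ 2 / 2 ∂(ρ₀ : Measure (Space d)) := by
  have hv : ∀ x, timeDeriv γ t x = v t (γ t x) := fun x =>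
    ((hc.1 x).2 t ht).derivWithin (uniqueDiffOn_Icc zero_lt_one t ht)
  have hvt : v t = velocity γ t := funext fun y => by
    rw [velocity, hv, hγ.apply_pathInv ht]
  have hcont : Continuous (v t) := by
    rw [hvt]
    exact hγ.continuousOn_velocity.comp_continuous (f := fun x => (t, x)) (by fun_prop)
      fun x => ⟨ht, mem_univ x⟩
  rw [kineticEnergy, hc.2 t ht, lintegral_map (by fun_prop) (hγ.measurable ht)]
  simp only [hv]

/-- The two actions agree: Tonelli's theorem exchanges the integrals over time and space in the
kinetic energy, which is then split off from the time integral of `F`. -/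
theorem Corresponds.dynamicAction_eq {ρ₀ : ProbabilityMeasure (Space d)}
    {ρ : ℝ → ProbabilityMeasure (Space d)} {v γ : ℝ → Space d → Space d}
    (hc : Corresponds ρ₀ ρ v γ) (hγ : IsDiffeoPath γ) (F : Measure (Space d) → EReal) :
    dynamicAction F ρ v = pathAction F ρ₀ γ := by
  have htime : ∀ᵐ t ∂timeMeasure, t ∈ Icc (0 : ℝ) 1 := ae_restrict_mem measurableSet_Icc
  have hjoint : AEMeasurable (Function.uncurry fun (t : ℝ) (x : Space d) =>
      ‖timeDeriv γ t x‖ₑ ^ 2 / 2) (timeMeasure.prod (ρ₀ : Measure (Space d))) := by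
    have := hγ.continuousOn_timeDeriv.aemeasurable (μ := (volume : Measure ℝ).prod
      (ρ₀ : Measure (Space d))) (measurableSet_Icc.prod MeasurableSet.univ)
    rw [← Measure.prod_restrict, Measure.restrict_univ] at this
    exact (this.enorm.pow_const 2).div_const 2
  have hkin : kineticEnergy ρ v =ᵐ[timeMeasure]
      fun t => ∫⁻ x, ‖timeDeriv γ t x‖ₑ ^ 2 / 2 ∂(ρ₀ : Measure (Space d)) := by
    filter_upwards [htime] with t ht using hc.kineticEnergy_eq hγ ht
  have hk : AEMeasurable (kineticEnergy ρ v) timeMeasure :=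
    hjoint.lintegral_prod_right'.congr hkin.symm
  have hK : ∫⁻ t, kineticEnergy ρ v t ∂timeMeasure =
      ∫⁻ x, ∫⁻ t, ‖derivWithin (fun s => γ s x) (Icc 0 1) t‖ₑ ^ 2 / 2 ∂timeMeasure
        ∂(ρ₀ : Measure (Space d)) := by
    rw [lintegral_congr_ae hkin]
    exact lintegral_lintegral_swap hjoint
  rw [dynamicAction, pathAction, ← hK]
  split_ifs with htop
  · rw [htop, EReal.coe_ennreal_top, addTop_top_left]
  · rw [extIntegral_addTop hk htop]
    congr 1
    refine extIntegral_congr_ae ?_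
    filter_upwards [htime] with t ht
    rw [hc.2 t ht]

end DensityPath

end

/-! ### Equivalence of the dynamic and the static problem -/

theorem theorem1 (d : ℕ) (ρ₀ ρ₁ : ProbabilityMeasure (DensityPath.Space d))
    (hρ₀ : (ρ₀ : Measure (DensityPath.Space d)) ≪ volume)
    (hρ₁ : (ρ₁ : Measure (DensityPath.Space d)) ≪ volume)
    (κ₀ κ₁ κ₂ : ℝ≥0) (V : DensityPath.Space d → ℝ) (U : ℝ → ℝ) (W : DensityPath.Space d → ℝ)
    (G F : Measure (DensityPath.Space d) → EReal)
    (hF : ∀ μ, F μ =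
      DensityPath.addTop (DensityPath.potentialEnergy κ₀ κ₁ κ₂ V U W μ) (G μ)) :
    DensityPath.dynamicValue F ρ₀ ρ₁ = DensityPath.staticValue F ρ₀ ρ₁ ∧
    (∀ (ρ : ℝ → ProbabilityMeasure (DensityPath.Space d))
        (v : ℝ → DensityPath.Space d → DensityPath.Space d),
      DensityPath.IsAdmissible ρ₀ ρ₁ ρ v →
        ∃ π ∈ DensityPath.diffeoCouplings ρ₀ ρ₁, ∃ γ, DensityPath.IsFlowPath ρ₀ π γ ∧
          DensityPath.Corresponds ρ₀ ρ v γ ∧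
          DensityPath.dynamicAction F ρ v = DensityPath.pathAction F ρ₀ γ) ∧
    (∀ π ∈ DensityPath.diffeoCouplings ρ₀ ρ₁,
      ∀ γ : ℝ → DensityPath.Space d → DensityPath.Space d, DensityPath.IsFlowPath ρ₀ π γ →
        ∃ (ρ : ℝ → ProbabilityMeasure (DensityPath.Space d))
          (v : ℝ → DensityPath.Space d → DensityPath.Space d),
          DensityPath.IsAdmissible ρ₀ ρ₁ ρ v ∧ DensityPath.Corresponds ρ₀ ρ v γ ∧
          DensityPath.dynamicAction F ρ v = DensityPath.pathAction F ρ₀ γ) := by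
  have hdyn : ∀ (ρ : ℝ → ProbabilityMeasure (DensityPath.Space d))
      (v : ℝ → DensityPath.Space d → DensityPath.Space d), DensityPath.IsAdmissible ρ₀ ρ₁ ρ v →
      ∃ π ∈ DensityPath.diffeoCouplings ρ₀ ρ₁, ∃ γ, DensityPath.IsFlowPath ρ₀ π γ ∧
        DensityPath.Corresponds ρ₀ ρ v γ ∧
        DensityPath.dynamicAction F ρ v = DensityPath.pathAction F ρ₀ γ := by
    intro ρ v h
    obtain ⟨π, hπ, γ, hγ, hc⟩ := h.exists_isFlowPath
    exact ⟨π, hπ, γ, hγ, hc, hc.dynamicAction_eq hγ.isDiffeoPath F⟩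
  have hstat : ∀ π ∈ DensityPath.diffeoCouplings ρ₀ ρ₁,
      ∀ γ : ℝ → DensityPath.Space d → DensityPath.Space d, DensityPath.IsFlowPath ρ₀ π γ →
      ∃ (ρ : ℝ → ProbabilityMeasure (DensityPath.Space d))
        (v : ℝ → DensityPath.Space d → DensityPath.Space d),
        DensityPath.IsAdmissible ρ₀ ρ₁ ρ v ∧ DensityPath.Corresponds ρ₀ ρ v γ ∧
        DensityPath.dynamicAction F ρ v = DensityPath.pathAction F ρ₀ γ := by
    intro π hπ γ hγ
    obtain ⟨ρ, hadm, hc⟩ := hγ.exists_isAdmissible hρ₀ hπ.1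
    exact ⟨ρ, _, hadm, hc, hc.dynamicAction_eq hγ.isDiffeoPath F⟩
  refine ⟨le_antisymm ?_ ?_, hdyn, hstat⟩
  · refine le_iInf₂ fun π hπ => le_iInf₂ fun γ hγ => ?_
    obtain ⟨ρ, v, hadm, -, heq⟩ := hstat π hπ γ hγ
    rw [← heq]
    exact iInf_le_of_le ρ (iInf₂_le v hadm)
  · refine le_iInf fun ρ => le_iInf₂ fun v h => ?_
    obtain ⟨π, hπ, γ, hγ, -, heq⟩ := hdyn ρ v h
    rw [heq]
    exact (iInf₂_le π hπ).trans (iInf₂_le γ hγ)
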